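/- Let $L(s)=\sum_{n\ge1}a_nn^{-s}$ be an ordinary Dirichlet series that converges somewhere and continues analytically to a half-plane $\operatorname{Re}s>\Omega$, $\Omega\in[-\infty,\infty)$. Assume that $L$ has polynomial growth on every vertical line of this half-plane, and that it satisfies the growth condition of the Phragmén–Lindelöf principle: in every closed vertical strip $\sigma_1\le\operatorname{Re}s\le\sigma_2$ with $\sigma_1>\Omega$ there are constants $B,c$ with $|L(s)|\le\exp(Be^{c|\operatorname{Im}s|})$ (for entire $L$ this holds as soon as $L$ has finite order). For $\sigma>\Omega$ put $$\mu(\sigma)=\inf\{\beta\ge0: L(\sigma+it)=O(|t|^\beta)\text{ as }|t|\to\infty\},\qquad \omega_\mu=\inf\{\sigma>\Omega:\mu(\sigma)=0\}.$$ We say that $\mu$ has slope $m$ at $\sigma$ if its left or its right derivative at $\sigma$ equals $m$ (in particular if $\mu'(\sigma)=m$). (1) If $\mu$ has slope $-s$ with $s\in(0,1)$ at a point $\sigma>\Omega$, then $$\mu(\sigma)\le\frac{s}{2(1-s)},\qquad\text{equivalently}\qquad s\ge\frac{2\mu(\sigma)}{2\mu(\sigma)+1}.$$ In particular $s\ge 2/3$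 if $\mu(\sigma)\ge1$, and $s\ge1/2$ if $\mu(\sigma)\ge1/2$; and for every $\varepsilon>0$ there is $M$, depending only on $\varepsilon$, such that $\mu(\sigma)\ge M$ forces $s>1-\varepsilon$. (2) If $\Omega\le x<y=\omega_\mu$ and $\mu'=-s$ on $(x,y)$ with a constant $s\in(0,1)$, then $y-x\le\frac1{2(1-s)}$. (3) Suppose that $L$ is entire ($\Omega=-\infty$) and has vertical degree $1$, that is, $-\lim_{\sigma\to-\infty}\mu'(\sigma)=1$ ($\mu'$ denoting the right derivative). Then at every $\sigma$ with $\mu(\sigma)\ge1$, every slope of $\mu$ lies in $[-1,-2/3]$. -/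

import Mathlib

open Filter Topology

/-- The order function `μ(σ) = inf {β ≥ 0 : f(σ + it) = O(|t|^β) as |t| → ∞}`. -/
noncomputable def lindelofMu (f : ℂ → ℂ) (σ : ℝ) : ℝ :=
  sInf {β : ℝ | 0 ≤ β ∧
    (fun t : ℝ => f ((σ : ℂ) + (t : ℂ) * Complex.I)) =O[cocompact ℝ] fun t : ℝ => |t| ^ β}

/-- The ordinary Dirichlet series `∑_{n ≥ 1} a n * n ^ (-s)` converges somewhere, and `f` is an
analytic continuation of it to the half-plane `Re s > Ω` (the whole plane if `Ω = ⊥`) which has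
polynomial growth on vertical lines and obeys the growth condition of the Phragmén–Lindelöf
principle in closed vertical strips. -/
structure ContinuesDirichletSeries (a : ℕ → ℂ) (f : ℂ → ℂ) (Ω : EReal) : Prop where
  converges : LSeries.abscissaOfAbsConv a < ⊤
  holomorphic : DifferentiableOn ℂ f {s : ℂ | Ω < (s.re : EReal)}
  eq_LSeries : ∀ s : ℂ, Ω < (s.re : EReal) → LSeries.abscissaOfAbsConv a < (s.re : EReal) →
    f s = LSeries a s
  line_growth : ∀ σ : ℝ, Ω < (σ : EReal) → ∃ β : ℝ,
    (fun t : ℝ => f ((σ : ℂ) + (t : ℂ) * Complex.I)) =O[cocompact ℝ] fun t : ℝ => |t| ^ β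
  strip_growth : ∀ σ₁ σ₂ : ℝ, Ω < (σ₁ : EReal) → ∃ B c : ℝ,
    ∀ s : ℂ, σ₁ ≤ s.re → s.re ≤ σ₂ → ‖f s‖ ≤ Real.exp (B * Real.exp (c * |s.im|))

/-- `ω_μ = inf {σ : μ(σ) = 0}`, the infimum being over the half-plane of continuation. -/
noncomputable def omegaMu (f : ℂ → ℂ) (Ω : EReal) : EReal :=
  sInf ((fun σ : ℝ => (σ : EReal)) '' {σ : ℝ | Ω < (σ : EReal) ∧ lindelofMu f σ = 0})

/-- `m` is a slope of `φ` at `x`: the left or the right derivative of `φ` at `x` exists and equals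
`m` (in particular this holds if `φ` has derivative `m` at `x`). -/
def HasSlopeAt (φ : ℝ → ℝ) (m x : ℝ) : Prop :=
  HasDerivWithinAt φ m (Set.Iio x) x ∨ HasDerivWithinAt φ m (Set.Ioi x) x

/-- The vertical degree `-lim_{σ → -∞} μ'(σ)` of an entire `f` is `d`. As `μ` need not be
differentiable at its corners, `μ'` is taken to be the right derivative. -/
def HasVerticalDegree (f : ℂ → ℂ) (d : ℝ) : Prop :=
  Tendsto (fun σ : ℝ => derivWithin (lindelofMu f) (Set.Ioi σ) σ) atBot (𝓝 (-d))

/-!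
Everything follows from the inequality `σ_a ≤ σ + μ(σ) + 1/2`, valid at every `σ` of the half-plane
of continuation, where `σ_a` is the abscissa of absolute convergence
(`ContinuesDirichletSeries.abscissaOfAbsConv_le`), together with the convexity of `μ`
(`ContinuesDirichletSeries.convexOn_lindelofMu`) and the vanishing of `μ` to the right of `σ_a`.
If `μ` has the slope `-s` at `σ`, the line of slope `-s` through `(σ, μ(σ))` supports the convex
function `μ`, so it is nonpositive beyond `σ_a`. Hence `μ(σ) ≤ s (σ_a - σ) ≤ s (μ(σ) + 1/2)`, which
is the constraint at a point. On a segment of slope `-s`, `μ` drops by `s` times the length of the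
segment, and `μ ≥ 0`, so the constraint near the left end bounds the length. For vertical degree
one, convexity makes the limit `-1` of the right derivative at `-∞` a lower bound for every slope.

For the convexity, `f(s) exp((s - iT)²) (1 + |T|)^(-l(s))`, with `l` the linear interpolation of
the exponents on the two edges of a strip, is bounded on the edges uniformly in `T`. The
Phragmén–Lindelöf principle then bounds it at height `T`.

The inequality for `σ_a` is a duality argument. The Gaussian average of `f(σ + it) n^(it)` over
`|t| ≲ T` equals, after shifting the line of integration into the region of absolute convergence,
`∑ m, a m * m^(-σ) * exp(-T² log²(n/m) / 4)`. For `T = N^(1 + η)` and `n ≤ N` this is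
`a n * n^(-σ)` up to a superpolynomially small error. Choose `ε n` of modulus at most `1` with
`ε n * (a n * n^(-σ)) = |a n| * n^(-σ)`. Then `∑ n ≤ N, |a n| * n^(-σ)` is, up to a bounded error,
the Gaussian average of `f(σ + it) ∑ n ≤ N, ε n * n^(it)`. The first factor has mean square
`O(T^(2β))` for each `β > μ(σ)`, and the second `O(N)`, so that the sum is
`O(N^(1/2 + (1 + η) β))`.
-/

open MeasureTheory

/-! ### Interpolation between two vertical lines -/

lemma one_add_rpow_le_exp_mul {u k : ℝ} (hu : 0 ≤ u) (hk : 0 ≤ k) :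
    (1 + u) ^ k ≤ Real.exp (u * k) := by
  rw [Real.exp_mul]
  exact Real.rpow_le_rpow (by positivity) (by linarith [Real.add_one_le_exp u]) hk

lemma one_add_rpow_mul_exp_neg_sq_le {u β : ℝ} (hu : 0 ≤ u) (hβ : 0 ≤ β) :
    (1 + u) ^ β * Real.exp (-u ^ 2) ≤ Real.exp (β ^ 2 / 4) := by
  have h1 := one_add_rpow_le_exp_mul hu hβ
  calc (1 + u) ^ β * Real.exp (-u ^ 2) ≤ Real.exp (u * β) * Real.exp (-u ^ 2) := by gcongr
    _ = Real.exp (u * β - u ^ 2) := by rw [← Real.exp_add]; ring_nf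
    _ ≤ Real.exp (β ^ 2 / 4) := Real.exp_le_exp.2 (by nlinarith [sq_nonneg (u - β / 2)])

lemma one_add_abs_le_mul (t T : ℝ) : 1 + |t| ≤ (1 + |T|) * (1 + |t - T|) := by
  have : |t| ≤ |t - T| + |T| := by simpa using abs_add_le (t - T) T
  nlinarith [abs_nonneg T, abs_nonneg (t - T), mul_nonneg (abs_nonneg T) (abs_nonneg (t - T))]

/-- A three lines theorem for polynomial bounds: in a strip where `f` satisfies the growth condition
of the Phragmén–Lindelöf principle, the exponent of a polynomial bound interpolates linearly between
those on the edges. -/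
lemma norm_le_rpow_interp_of_edges {f : ℂ → ℂ} {a b β₁ β₂ B c C₁ C₂ : ℝ} (hab : a < b)
    (hf : DiffContOnCl ℂ f (Complex.re ⁻¹' Set.Ioo a b)) (hβ₁ : 0 ≤ β₁) (hβ₂ : 0 ≤ β₂)
    (hc : c < Real.pi / (b - a))
    (hB : ∀ s : ℂ, a < s.re → s.re < b → ‖f s‖ ≤ Real.exp (B * Real.exp (c * |s.im|)))
    (h₁ : ∀ s : ℂ, s.re = a → ‖f s‖ ≤ C₁ * (1 + |s.im|) ^ β₁)
    (h₂ : ∀ s : ℂ, s.re = b → ‖f s‖ ≤ C₂ * (1 + |s.im|) ^ β₂) :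
    ∃ C : ℝ, ∀ s : ℂ, a ≤ s.re → s.re ≤ b →
      ‖f s‖ ≤ C * (1 + |s.im|) ^ (β₁ + (β₂ - β₁) * ((s.re - a) / (b - a))) := by
  have hba : 0 < b - a := sub_pos.2 hab
  set M : ℝ := max (a ^ 2) (b ^ 2) with hM
  have hsq : ∀ x : ℝ, a ≤ x → x ≤ b → x ^ 2 ≤ M := by
    intro x hx hx'
    rcases le_total 0 x with h | h
    · exact le_max_of_le_right (by nlinarith)
    · exact le_max_of_le_left (by nlinarith)
  have hC₁ : 0 ≤ C₁ := by
    have := (norm_nonneg _).trans (h₁ (a : ℂ) (by simp))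
    simpa using this
  have hC₂ : 0 ≤ C₂ := by
    have := (norm_nonneg _).trans (h₂ (b : ℂ) (by simp))
    simpa using this
  set D : ℝ := max (C₁ * (Real.exp M * Real.exp (β₁ ^ 2 / 4)))
    (C₂ * (Real.exp M * Real.exp (β₂ ^ 2 / 4))) with hD
  set l : ℂ → ℂ := fun s => (β₁ : ℂ) + ((β₂ - β₁ : ℝ) : ℂ) * ((s - a) / ((b - a : ℝ) : ℂ)) with hl
  have hlre : ∀ s : ℂ, (l s).re = β₁ + (β₂ - β₁) * ((s.re - a) / (b - a)) := by
    intro s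
    simp [hl, Complex.div_ofReal_re, -Complex.ofReal_sub]
  have hl0 : ∀ s : ℂ, a ≤ s.re → s.re ≤ b → 0 ≤ (l s).re := by
    intro s hs hs'
    rw [hlre]
    have h0 : 0 ≤ (s.re - a) / (b - a) := div_nonneg (by linarith) hba.le
    have h1 : (s.re - a) / (b - a) ≤ 1 := (div_le_one hba).2 (by linarith)
    nlinarith
  have hnorm : ∀ (T : ℝ) (z : ℂ),
      ‖Complex.exp ((z - T * Complex.I) ^ 2 - l z * Real.log (1 + |T|))‖ =
        Real.exp (z.re ^ 2) * Real.exp (-|z.im - T| ^ 2) * ((1 + |T|) ^ (l z).re)⁻¹ := by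
    intro T z
    have hT0 : 0 < 1 + |T| := by positivity
    rw [Complex.norm_exp, Real.rpow_def_of_pos hT0, ← Real.exp_neg, ← Real.exp_add,
      ← Real.exp_add, sq_abs]
    congr 1
    simp [pow_two]
    ring
  -- the multiplier concentrates on the height `T` and normalises by the expected bound there
  have key : ∀ T : ℝ, ∀ s : ℂ, a ≤ s.re → s.re ≤ b →
      ‖f s * Complex.exp ((s - T * Complex.I) ^ 2 - l s * Real.log (1 + |T|))‖ ≤ D := by
    intro T s hs hs'
    have hT0 : 0 < 1 + |T| := by positivity
    have edge : ∀ (z : ℂ) (β C' : ℝ), 0 ≤ β → 0 ≤ C' → a ≤ z.re → z.re ≤ b → (l z).re = β →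
        ‖f z‖ ≤ C' * (1 + |z.im|) ^ β →
        ‖f z * Complex.exp ((z - T * Complex.I) ^ 2 - l z * Real.log (1 + |T|))‖ ≤
          C' * (Real.exp M * Real.exp (β ^ 2 / 4)) := by
      intro z β C' hβ hC' hz hz' hlz hfz
      rw [norm_mul, hnorm, hlz]
      have e1 : (1 + |z.im|) ^ β ≤ (1 + |T|) ^ β * (1 + |z.im - T|) ^ β := by
        rw [← Real.mul_rpow (by positivity) (by positivity)]
        exact Real.rpow_le_rpow (by positivity) (one_add_abs_le_mul _ _) hβ
      have e2 := one_add_rpow_mul_exp_neg_sq_le (abs_nonneg (z.im - T)) hβ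
      have hp : 0 < (1 + |T|) ^ β := Real.rpow_pos_of_pos hT0 _
      calc ‖f z‖ * (Real.exp (z.re ^ 2) * Real.exp (-|z.im - T| ^ 2) * ((1 + |T|) ^ β)⁻¹)
          ≤ (C' * ((1 + |T|) ^ β * (1 + |z.im - T|) ^ β)) *
            (Real.exp M * Real.exp (-|z.im - T| ^ 2) * ((1 + |T|) ^ β)⁻¹) := by
            gcongr
            · exact hfz.trans (by gcongr)
            · exact hsq _ hz hz'
        _ = C' * (Real.exp M * ((1 + |z.im - T|) ^ β * Real.exp (-|z.im - T| ^ 2))) := by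
            field_simp
        _ ≤ _ := by gcongr
    refine PhragmenLindelof.vertical_strip (a := a) (b := b) (f := fun z =>
      f z * Complex.exp ((z - T * Complex.I) ^ 2 - l z * Real.log (1 + |T|)))
      ?_ ⟨c, hc, B, ?_⟩ ?_ ?_ hs hs'
    · have he : Differentiable ℂ fun z : ℂ =>
          Complex.exp ((z - T * Complex.I) ^ 2 - l z * Real.log (1 + |T|)) := by
        simp only [hl]
        fun_prop
      exact hf.smul he.diffContOnCl
    · refine Asymptotics.IsBigO.of_bound (Real.exp M) ?_
      refine eventually_inf_principal.2 (Eventually.of_forall fun z hz => ?_)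
      rw [norm_mul, hnorm, Real.norm_of_nonneg (Real.exp_pos _).le, mul_comm]
      have hz1 : a ≤ z.re := hz.1.le
      have hz2 : z.re ≤ b := hz.2.le
      have : 1 ≤ (1 + |T|) ^ (l z).re :=
        Real.one_le_rpow (by linarith [abs_nonneg T]) (hl0 z hz1 hz2)
      have e1 : Real.exp (-|z.im - T| ^ 2) ≤ 1 :=
        Real.exp_le_one_iff.2 (by nlinarith [sq_nonneg (|z.im - T|)])
      have e2 : ((1 + |T|) ^ (l z).re)⁻¹ ≤ 1 := inv_le_one_of_one_le₀ this
      have e3 : Real.exp (z.re ^ 2) ≤ Real.exp M := Real.exp_le_exp.2 (hsq _ hz1 hz2)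
      have e4 : (0:ℝ) ≤ ((1 + |T|) ^ (l z).re)⁻¹ := by positivity
      gcongr
      · calc _ ≤ Real.exp M * 1 * 1 := by gcongr
          _ = _ := by ring
      · exact hB z hz.1 hz.2
    · intro z hz
      refine (edge z β₁ C₁ hβ₁ hC₁ hz.ge (by linarith) ?_ (h₁ z hz)).trans (le_max_left _ _)
      rw [hlre, hz]; simp
    · intro z hz
      refine (edge z β₂ C₂ hβ₂ hC₂ (by linarith) hz.le ?_ (h₂ z hz)).trans (le_max_right _ _)
      rw [hlre, hz, div_self hba.ne']; ring
  refine ⟨D, fun s hs hs' => ?_⟩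
  have h := key s.im s hs hs'
  have hp : 0 < (1 + |s.im|) ^ (l s).re := Real.rpow_pos_of_pos (by positivity) _
  rw [norm_mul, hnorm, sub_self, abs_zero, ← div_eq_mul_inv, ← mul_div_assoc, div_le_iff₀ hp] at h
  rw [← hlre]
  refine le_trans ?_ h
  have : 1 ≤ Real.exp (s.re ^ 2) := Real.one_le_exp (sq_nonneg _)
  simpa using le_mul_of_one_le_right (norm_nonneg (f s)) this

/-! ### Growth in strips and convexity of the order function -/

lemma exists_le_one_add_abs_rpow_of_isBigO {g : ℝ → ℂ} {β : ℝ} (hg : Continuous g) (hβ : 0 ≤ β)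
    (h : g =O[cocompact ℝ] fun t : ℝ => |t| ^ β) :
    ∃ C : ℝ, ∀ t : ℝ, ‖g t‖ ≤ C * (1 + |t|) ^ β := by
  obtain ⟨c, hc, hcg⟩ := h.exists_nonneg
  rw [Asymptotics.isBigOWith_iff, eventually_iff, mem_cocompact] at hcg
  obtain ⟨K, hK, hKg⟩ := hcg
  obtain ⟨M, hM⟩ := hK.exists_bound_of_continuousOn hg.continuousOn
  refine ⟨max c M, fun t => ?_⟩
  have h1 : 1 ≤ (1 + |t|) ^ β := Real.one_le_rpow (by linarith [abs_nonneg t]) hβ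
  by_cases ht : t ∈ K
  · exact (hM t ht).trans <| (le_max_right c M).trans <|
      le_mul_of_one_le_right (hc.trans (le_max_left _ _)) h1
  · have h2 : ‖g t‖ ≤ c * ‖|t| ^ β‖ := hKg ht
    rw [Real.norm_of_nonneg (by positivity)] at h2
    refine h2.trans ?_
    have : |t| ^ β ≤ (1 + |t|) ^ β := Real.rpow_le_rpow (abs_nonneg _) (by linarith) hβ
    exact mul_le_mul (le_max_left _ _) this (by positivity) (hc.trans (le_max_left _ _))

lemma abs_rpow_isBigO_of_le {β γ : ℝ} (h : β ≤ γ) :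
    (fun t : ℝ => |t| ^ β) =O[cocompact ℝ] fun t : ℝ => |t| ^ γ := by
  refine Asymptotics.IsBigO.of_bound 1 ?_
  have : ∀ᶠ t : ℝ in cocompact ℝ, 1 ≤ ‖t‖ := (tendsto_norm_cocompact_atTop).eventually_ge_atTop 1
  filter_upwards [this] with t ht
  rw [Real.norm_eq_abs] at ht
  rw [Real.norm_of_nonneg (by positivity), Real.norm_of_nonneg (by positivity), one_mul]
  exact Real.rpow_le_rpow_of_exponent_le ht h

lemma lindelofMu_nonneg (f : ℂ → ℂ) (σ : ℝ) : 0 ≤ lindelofMu f σ :=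
  Real.sInf_nonneg fun _ h => h.1

lemma lindelofMu_le_of_le_one_add_abs_rpow {f : ℂ → ℂ} {σ β C : ℝ} (hβ : 0 ≤ β)
    (h : ∀ t : ℝ, ‖f ((σ : ℂ) + (t : ℂ) * Complex.I)‖ ≤ C * (1 + |t|) ^ β) :
    lindelofMu f σ ≤ β := by
  have hC : 0 ≤ C := by simpa using (norm_nonneg _).trans (h 0)
  refine csInf_le ⟨0, fun _ h => h.1⟩ ⟨hβ, Asymptotics.IsBigO.of_bound (C * 2 ^ β) ?_⟩
  have : ∀ᶠ t : ℝ in cocompact ℝ, 1 ≤ ‖t‖ := (tendsto_norm_cocompact_atTop).eventually_ge_atTop 1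
  filter_upwards [this] with t ht
  rw [Real.norm_eq_abs] at ht
  rw [Real.norm_of_nonneg (by positivity), mul_assoc, ← Real.mul_rpow (by norm_num) (abs_nonneg _)]
  refine (h t).trans ?_
  gcongr
  linarith

/-- Polynomial growth implies the growth condition of the Phragmén–Lindelöf principle with an
arbitrarily small exponent `δ`. -/
lemma mul_one_add_rpow_le_exp_exp {C k δ u : ℝ} (hC : 0 ≤ C) (hk : 0 ≤ k) (hδ : 0 < δ) (hu : 0 ≤ u) :
    C * (1 + u) ^ k ≤ Real.exp ((C + k / δ) * Real.exp (δ * u)) := by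
  have h1 := one_add_rpow_le_exp_mul hu hk
  have h2 : C ≤ Real.exp C := by linarith [Real.add_one_le_exp C]
  have h3 : 1 ≤ Real.exp (δ * u) := Real.one_le_exp (by positivity)
  have h4 : δ * u ≤ Real.exp (δ * u) := by linarith [Real.add_one_le_exp (δ * u)]
  calc C * (1 + u) ^ k ≤ Real.exp C * Real.exp (u * k) := by gcongr
    _ = Real.exp (C + k / δ * (δ * u)) := by rw [← Real.exp_add]; congr 1; field_simp
    _ ≤ _ := by
      apply Real.exp_le_exp.2
      have : 0 ≤ k / δ := by positivity
      nlinarith [mul_le_mul_of_nonneg_left h4 this]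

namespace ContinuesDirichletSeries

variable {a : ℕ → ℂ} {f : ℂ → ℂ} {Ω : EReal}

lemma continuous_vertical (H : ContinuesDirichletSeries a f Ω) {σ : ℝ} (hσ : Ω < (σ : EReal)) :
    Continuous fun t : ℝ => f ((σ : ℂ) + (t : ℂ) * Complex.I) := by
  have h := H.holomorphic.continuousOn
  refine h.comp_continuous (by fun_prop) fun t => ?_
  simpa using hσ

lemma diffContOnCl_strip (H : ContinuesDirichletSeries a f Ω) {σ₁ : ℝ} (h : Ω < (σ₁ : EReal))
    (σ₂ : ℝ) : DiffContOnCl ℂ f (Complex.re ⁻¹' Set.Ioo σ₁ σ₂) := by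
  refine DifferentiableOn.diffContOnCl (H.holomorphic.mono ?_)
  have hcl : closure (Complex.re ⁻¹' Set.Ioo σ₁ σ₂) ⊆ Complex.re ⁻¹' Set.Icc σ₁ σ₂ :=
    closure_minimal (Set.preimage_mono Set.Ioo_subset_Icc_self)
      (isClosed_Icc.preimage Complex.continuous_re)
  intro s hs
  exact h.trans_le (EReal.coe_le_coe_iff.2 (hcl hs).1)

lemma exists_line_bound (H : ContinuesDirichletSeries a f Ω) {σ β : ℝ} (hσ : Ω < (σ : EReal))
    (hβ : lindelofMu f σ < β) :
    ∃ C : ℝ, ∀ t : ℝ, ‖f ((σ : ℂ) + (t : ℂ) * Complex.I)‖ ≤ C * (1 + |t|) ^ β := by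
  have hne : {β : ℝ | 0 ≤ β ∧
    (fun t : ℝ => f ((σ : ℂ) + (t : ℂ) * Complex.I)) =O[cocompact ℝ]
      fun t : ℝ => |t| ^ β}.Nonempty := by
    obtain ⟨γ, hγ⟩ := H.line_growth σ hσ
    exact ⟨max γ 0, le_max_right _ _, hγ.trans (abs_rpow_isBigO_of_le (le_max_left _ _))⟩
  obtain ⟨γ, hγ, hγβ⟩ := exists_lt_of_csInf_lt hne hβ
  exact exists_le_one_add_abs_rpow_of_isBigO (H.continuous_vertical hσ)
    (hγ.1.trans hγβ.le) (hγ.2.trans (abs_rpow_isBigO_of_le hγβ.le))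

lemma exists_line_bound_re (H : ContinuesDirichletSeries a f Ω) {σ β : ℝ} (hσ : Ω < (σ : EReal))
    (hβ : lindelofMu f σ < β) :
    ∃ C : ℝ, ∀ s : ℂ, s.re = σ → ‖f s‖ ≤ C * (1 + |s.im|) ^ β := by
  obtain ⟨C, hC⟩ := H.exists_line_bound hσ hβ
  refine ⟨C, fun s hs => ?_⟩
  have := hC s.im
  rwa [← hs, Complex.re_add_im] at this

/-- Polynomial growth on a strip. The growth hypothesis has an arbitrary exponent `c`, so the
Phragmén–Lindelöf principle is applied to substrips of width less than `π / c`. -/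
lemma exists_strip_bound (H : ContinuesDirichletSeries a f Ω) {σ₁ : ℝ} (h : Ω < (σ₁ : EReal))
    (σ₂ : ℝ) : ∃ C k : ℝ, 0 ≤ C ∧ 0 ≤ k ∧ ∀ s : ℂ, σ₁ ≤ s.re → s.re ≤ σ₂ →
      ‖f s‖ ≤ C * (1 + |s.im|) ^ k := by
  by_cases h12 : σ₁ ≤ σ₂
  swap
  · exact ⟨0, 0, le_rfl, le_rfl, fun s hs hs' => absurd (hs.trans hs') h12⟩
  -- the margin `1` leaves room for the last substrip, whose width is `δ ≤ 1`
  obtain ⟨B, c, hBc⟩ := H.strip_growth σ₁ (σ₂ + 1) h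
  obtain ⟨δ, hδ, hδ1, hδc⟩ : ∃ δ : ℝ, 0 < δ ∧ δ ≤ 1 ∧ c < Real.pi / δ := by
    have hc : 0 < |c| + 4 := by positivity
    refine ⟨Real.pi / (|c| + 4), by positivity, ?_, ?_⟩
    · rw [div_le_one hc]
      linarith [Real.pi_le_four, abs_nonneg c]
    · rw [div_div_cancel₀ Real.pi_ne_zero]
      linarith [le_abs_self c]
  have narrow : ∀ x : ℝ, σ₁ ≤ x → x + δ ≤ σ₂ + 1 → ∃ C k : ℝ, 0 ≤ C ∧ 0 ≤ k ∧
      ∀ s : ℂ, x ≤ s.re → s.re ≤ x + δ → ‖f s‖ ≤ C * (1 + |s.im|) ^ k := by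
    intro x hx hx'
    have hΩ : Ω < (x : EReal) := h.trans_le (EReal.coe_le_coe_iff.2 hx)
    have hΩ' : Ω < ((x + δ : ℝ) : EReal) := hΩ.trans (EReal.coe_lt_coe_iff.2 (by linarith))
    obtain ⟨C₁, hC₁⟩ := H.exists_line_bound_re hΩ (lt_add_one _)
    obtain ⟨C₂, hC₂⟩ := H.exists_line_bound_re hΩ' (lt_add_one _)
    set β₁ := lindelofMu f x + 1
    set β₂ := lindelofMu f (x + δ) + 1
    have hβ₁ : 0 ≤ β₁ := by linarith [lindelofMu_nonneg f x]
    have hβ₂ : 0 ≤ β₂ := by linarith [lindelofMu_nonneg f (x + δ)]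
    obtain ⟨C, hC⟩ := norm_le_rpow_interp_of_edges (by linarith) (H.diffContOnCl_strip hΩ (x + δ))
      hβ₁ hβ₂ (by rwa [add_sub_cancel_left])
      (fun s hs hs' => hBc s (by linarith) (by linarith)) hC₁ hC₂
    refine ⟨max C 0, β₁ + β₂, le_max_right _ _, by linarith, fun s hs hs' => ?_⟩
    refine (hC s hs hs').trans ?_
    have h0 : 0 ≤ (s.re - x) / (x + δ - x) := div_nonneg (by linarith) (by linarith)
    have h1 : (s.re - x) / (x + δ - x) ≤ 1 := (div_le_one (by linarith)).2 (by linarith)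
    refine mul_le_mul (le_max_left _ _) ?_ (by positivity) (le_max_right _ _)
    exact Real.rpow_le_rpow_of_exponent_le (by linarith [abs_nonneg s.im]) (by nlinarith)
  have step : ∀ n : ℕ, σ₁ + n * δ ≤ σ₂ + 1 → ∃ C k : ℝ, 0 ≤ C ∧ 0 ≤ k ∧
      ∀ s : ℂ, σ₁ ≤ s.re → s.re ≤ σ₁ + n * δ → ‖f s‖ ≤ C * (1 + |s.im|) ^ k := by
    intro n
    induction n with
    | zero =>
      intro _
      obtain ⟨C, hC⟩ := H.exists_line_bound_re h (lt_add_one _)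
      have hC0 : 0 ≤ C := by simpa using (norm_nonneg _).trans (hC σ₁ (by simp))
      exact ⟨C, _, hC0, by linarith [lindelofMu_nonneg f σ₁], fun s hs hs' =>
        hC s (le_antisymm (by simpa using hs') hs)⟩
    | succ n ih =>
      intro hn
      push_cast at hn
      obtain ⟨C₁, k₁, hC₁, hk₁, hb₁⟩ := ih (by linarith)
      have hnδ : 0 ≤ n * δ := by positivity
      obtain ⟨C₂, k₂, hC₂, hk₂, hb₂⟩ := narrow (σ₁ + n * δ) (by linarith) (by linarith)
      refine ⟨C₁ + C₂, k₁ + k₂, by linarith, by linarith, fun s hs hs' => ?_⟩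
      have hone : 1 ≤ 1 + |s.im| := by linarith [abs_nonneg s.im]
      push_cast at hs'
      rcases le_total s.re (σ₁ + n * δ) with hle | hle
      · refine (hb₁ s hs hle).trans ?_
        gcongr <;> linarith
      · refine (hb₂ s hle (by linarith)).trans ?_
        gcongr <;> linarith
  have hn := Nat.ceil_lt_add_one (div_nonneg (sub_nonneg.2 h12) hδ.le)
  have hn' := Nat.le_ceil ((σ₂ - σ₁) / δ)
  set n := ⌈(σ₂ - σ₁) / δ⌉₊
  rw [div_le_iff₀ hδ] at hn'
  have hn2 : n * δ ≤ (σ₂ - σ₁) + δ := by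
    have := mul_le_mul_of_nonneg_right hn.le hδ.le
    rwa [add_mul, div_mul_cancel₀ _ hδ.ne', one_mul] at this
  obtain ⟨C, k, hC, hk, hb⟩ := step n (by linarith)
  exact ⟨C, k, hC, hk, fun s hs hs' => hb s hs (by linarith)⟩

/-- Both edges of a strip admit the exponents `μ + ε`, and by polynomial growth in the strip
three-line interpolation applies whatever its width. -/
lemma convexOn_lindelofMu (H : ContinuesDirichletSeries a f Ω) :
    ConvexOn ℝ {σ : ℝ | Ω < (σ : EReal)} (lindelofMu f) := by
  refine LinearOrder.convexOn_of_lt ?_ ?_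
  · refine Set.OrdConnected.convex ⟨fun x hx y _ z hz => ?_⟩
    exact lt_of_lt_of_le hx (EReal.coe_le_coe_iff.2 hz.1)
  · intro x hx y hy hxy p q hp hq hpq
    refine le_of_forall_pos_le_add fun ε hε => ?_
    obtain ⟨C₁, hC₁⟩ := H.exists_line_bound_re hx (lt_add_of_pos_right _ hε)
    obtain ⟨C₂, hC₂⟩ := H.exists_line_bound_re hy (lt_add_of_pos_right _ hε)
    set β₁ := lindelofMu f x + ε with hβ₁'
    set β₂ := lindelofMu f y + ε with hβ₂'
    have hβ₁ : 0 ≤ β₁ := by linarith [lindelofMu_nonneg f x]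
    have hβ₂ : 0 ≤ β₂ := by linarith [lindelofMu_nonneg f y]
    obtain ⟨C₀, k, hC₀, hk, hb⟩ := H.exists_strip_bound hx y
    have hyx : 0 < y - x := sub_pos.2 hxy
    have hδ : 0 < Real.pi / (y - x) / 2 := by positivity
    obtain ⟨C, hC⟩ := norm_le_rpow_interp_of_edges hxy (H.diffContOnCl_strip hx y) hβ₁ hβ₂
      (half_lt_self (div_pos Real.pi_pos hyx))
      (fun s hs hs' => (hb s hs.le hs'.le).trans
        (mul_one_add_rpow_le_exp_exp hC₀ hk hδ (abs_nonneg s.im))) hC₁ hC₂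
    have hq' : (p * x + q * y - x) / (y - x) = q := by
      rw [div_eq_iff hyx.ne', eq_sub_of_add_eq hpq]
      ring
    have hm : p * x + q * y = x + q * (y - x) := by
      rw [eq_sub_of_add_eq hpq]
      ring
    have hm1 : x ≤ p * x + q * y := by nlinarith
    have hm2 : p * x + q * y ≤ y := by nlinarith
    have hle : lindelofMu f (p * x + q * y) ≤ β₁ + (β₂ - β₁) * q := by
      refine lindelofMu_le_of_le_one_add_abs_rpow (C := C) ?_ fun t => ?_
      · nlinarith
      · have := hC (((p * x + q * y : ℝ) : ℂ) + (t : ℂ) * Complex.I) (by simpa using hm1)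
          (by simpa using hm2)
        simpa [hq'] using this
    simp only [smul_eq_mul]
    refine hle.trans (le_of_eq ?_)
    rw [hβ₁', hβ₂', eq_sub_of_add_eq hpq]
    ring

end ContinuesDirichletSeries

/-! ### Gaussian averages of a Dirichlet series on a vertical line -/

/-- Shift of a vertical line of integration for a function of Gaussian decay in a strip, by Cauchy's
theorem on rectangles. -/
lemma integral_vertical_line_eq {G : ℂ → ℂ} {σ c K b : ℝ} (hσc : σ ≤ c) (hb : 0 < b)
    (hG : DifferentiableOn ℂ G (Complex.re ⁻¹' Set.Icc σ c))
    (hK : ∀ s : ℂ, σ ≤ s.re → s.re ≤ c → ‖G s‖ ≤ K * Real.exp (-b * s.im ^ 2)) :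
    ∫ t : ℝ, G ((σ : ℂ) + (t : ℂ) * Complex.I) = ∫ t : ℝ, G ((c : ℂ) + (t : ℂ) * Complex.I) := by
  have hint : ∀ x : ℝ, σ ≤ x → x ≤ c →
      Integrable fun t : ℝ => G ((x : ℂ) + (t : ℂ) * Complex.I) := by
    intro x hx hx'
    have hcont : Continuous fun t : ℝ => G ((x : ℂ) + (t : ℂ) * Complex.I) :=
      hG.continuousOn.comp_continuous (by fun_prop) fun t => by simp [hx, hx']
    refine ((integrable_exp_neg_mul_sq hb).const_mul K).mono' hcont.aestronglyMeasurable
      (Eventually.of_forall fun t => ?_)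
    simpa using hK ((x : ℂ) + (t : ℂ) * Complex.I) (by simpa) (by simpa)
  have hlim : ∀ x : ℝ, σ ≤ x → x ≤ c →
      Tendsto (fun T : ℝ => ∫ t in (-T)..T, G ((x : ℂ) + (t : ℂ) * Complex.I)) atTop
        (𝓝 (∫ t : ℝ, G ((x : ℂ) + (t : ℂ) * Complex.I))) := fun x hx hx' =>
    intervalIntegral_tendsto_integral (hint x hx hx') tendsto_neg_atTop_atBot tendsto_id
  have hzero : Tendsto (fun T : ℝ => K * Real.exp (-b * T ^ 2) * |c - σ|) atTop (𝓝 0) := by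
    have h1 : Tendsto (fun T : ℝ => Real.exp (-b * T ^ 2)) atTop (𝓝 0) := by
      refine Real.tendsto_exp_atBot.comp ?_
      exact (tendsto_pow_atTop two_ne_zero).const_mul_atTop_of_neg (neg_lt_zero.2 hb)
    simpa using (h1.const_mul K).mul_const |c - σ|
  have hhor : ∀ e : ℝ, e ^ 2 = 1 →
      Tendsto (fun T : ℝ => ∫ x in σ..c, G ((x : ℂ) + ((e * T : ℝ) : ℂ) * Complex.I)) atTop
        (𝓝 0) := by
    intro e he
    refine squeeze_zero_norm (fun T => ?_) hzero
    refine intervalIntegral.norm_integral_le_of_norm_le_const fun x hx => ?_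
    rw [Set.uIoc_of_le hσc] at hx
    have := hK ((x : ℂ) + ((e * T : ℝ) : ℂ) * Complex.I) (by simpa using hx.1.le)
      (by simpa using hx.2)
    simpa [mul_pow, he] using this
  have hrect : ∀ T : ℝ, Complex.I * (∫ t in (-T)..T, G ((c : ℂ) + (t : ℂ) * Complex.I)) -
      Complex.I * (∫ t in (-T)..T, G ((σ : ℂ) + (t : ℂ) * Complex.I)) =
      (∫ x in σ..c, G ((x : ℂ) + ((1 * T : ℝ) : ℂ) * Complex.I)) -
      ∫ x in σ..c, G ((x : ℂ) + ((-1 * T : ℝ) : ℂ) * Complex.I) := by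
    intro T
    have := Complex.integral_boundary_rect_eq_zero_of_differentiableOn G
      ⟨σ, -T⟩ ⟨c, T⟩ (hG.mono fun s hs => by
        have := hs.1
        simpa [Set.uIcc_of_le hσc] using this)
    simp only [smul_eq_mul] at this
    rw [one_mul, neg_one_mul]
    linear_combination this
  have h1 := ((hlim c hσc le_rfl).const_mul Complex.I).sub
    ((hlim σ le_rfl hσc).const_mul Complex.I)
  have h2 := (hhor 1 (by norm_num)).sub (hhor (-1) (by norm_num))
  simp_rw [hrect] at h1
  have h3 := tendsto_nhds_unique h1 h2
  rw [sub_zero, ← mul_sub] at h3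
  exact (sub_eq_zero.1 ((mul_eq_zero.1 h3).resolve_left Complex.I_ne_zero)).symm

lemma one_add_abs_rpow_mul_gaussian_le {k b : ℝ} (hk : 0 ≤ k) (hb : 0 < b) (t : ℝ) :
    (1 + |t|) ^ k * Real.exp (-b * t ^ 2) ≤
      Real.exp (k ^ 2 / (2 * b)) * Real.exp (-(b / 2) * t ^ 2) := by
  have h1 := one_add_rpow_le_exp_mul (abs_nonneg t) hk
  calc _ ≤ Real.exp (|t| * k) * Real.exp (-b * t ^ 2) := by gcongr
    _ = Real.exp (|t| * k + -b * t ^ 2) := by rw [← Real.exp_add]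
    _ ≤ Real.exp (k ^ 2 / (2 * b) + -(b / 2) * t ^ 2) := by
      apply Real.exp_le_exp.2
      have h2 : 0 ≤ (b * |t| - k) ^ 2 / (2 * b) := by positivity
      have h3 : (b * |t| - k) ^ 2 / (2 * b) =
          k ^ 2 / (2 * b) + (b / 2) * |t| ^ 2 - |t| * k := by
        field_simp
        ring
      rw [sq_abs] at h3
      linarith
    _ = _ := by rw [Real.exp_add]

/-- The value does not depend on the line `κ` of integration. -/
lemma integral_cexp_line {b : ℝ} (hb : 0 < b) (κ L : ℝ) :
    ∫ t : ℝ, Complex.exp ((κ + t * Complex.I) * L + b * (κ + t * Complex.I) ^ 2) =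
      ((√(Real.pi / b) * Real.exp (-L ^ 2 / (4 * b)) : ℝ) : ℂ) := by
  have h := integral_cexp_quadratic (b := ((-b : ℝ) : ℂ)) (by simpa using hb)
    ((2 * b * κ + L : ℝ) * Complex.I) ((κ * L + b * κ ^ 2 : ℝ))
  have hb' : (b : ℂ) ≠ 0 := by exact_mod_cast hb.ne'
  rw [show (fun t : ℝ => Complex.exp ((κ + t * Complex.I) * L + b * (κ + t * Complex.I) ^ 2)) =
    fun t : ℝ => Complex.exp (((-b : ℝ) : ℂ) * t ^ 2 + (2 * b * κ + L : ℝ) * Complex.I * t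
      + (κ * L + b * κ ^ 2 : ℝ)) from ?_, h]
  · rw [Complex.ofReal_mul, Real.sqrt_eq_rpow, Complex.ofReal_cpow (by positivity),
      Complex.ofReal_exp]
    congr 1
    · simp
    · congr 1
      push_cast
      rw [mul_pow, Complex.I_sq]
      field_simp
      ring
  · funext t
    congr 1
    push_cast
    linear_combination (b * (t : ℂ) ^ 2) * Complex.I_sq

lemma norm_cexp_line (b κ L t : ℝ) :
    ‖Complex.exp ((κ + t * Complex.I) * L + b * (κ + t * Complex.I) ^ 2)‖ =
      Real.exp (κ * L + b * κ ^ 2) * Real.exp (-b * t ^ 2) := by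
  rw [Complex.norm_exp, ← Real.exp_add]
  congr 1
  simp [pow_two]
  ring

lemma term_eq_term_mul_cexp (a : ℕ → ℂ) (s z : ℂ) (m : ℕ) :
    LSeries.term a (s + z) m = LSeries.term a s m * Complex.exp (-z * Real.log m) := by
  rcases eq_or_ne m 0 with rfl | hm
  · simp
  have hm' : (m : ℂ) ≠ 0 := by exact_mod_cast hm
  rw [LSeries.term_of_ne_zero hm, LSeries.term_of_ne_zero hm, Complex.cpow_add _ _ hm',
    Complex.cpow_def_of_ne_zero hm' z, neg_mul, Complex.exp_neg, Complex.natCast_log]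
  field_simp

namespace ContinuesDirichletSeries

variable {a : ℕ → ℂ} {f : ℂ → ℂ} {Ω : EReal}

/-- The Gaussian average on the line `Re s = σ`, to the left of the region of absolute convergence,
is the sum of the averages of the terms of the series. The line is shifted to `Re s = c`, where the
series can be integrated termwise, and each term shifted back. -/
lemma hasSum_gaussian_average (H : ContinuesDirichletSeries a f Ω) {σ c b : ℝ}
    (hσ : Ω < (σ : EReal)) (hσc : σ ≤ c) (hc : LSeries.abscissaOfAbsConv a < (c : EReal))
    (hb : 0 < b) (ℓ : ℝ) :
    HasSum (fun m : ℕ => LSeries.term a σ m *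
        ((√(Real.pi / b) * Real.exp (-(ℓ - Real.log m) ^ 2 / (4 * b)) : ℝ) : ℂ))
      (∫ t : ℝ, f ((σ : ℂ) + (t : ℂ) * Complex.I) *
        Complex.exp ((t : ℂ) * Complex.I * ℓ + b * ((t : ℂ) * Complex.I) ^ 2)) := by
  set κ : ℝ := c - σ with hκ
  set G : ℂ → ℂ := fun s => f s * Complex.exp ((s - σ) * ℓ + b * (s - σ) ^ 2) with hGdef
  obtain ⟨C, k, hC, hk, hbd⟩ := H.exists_strip_bound hσ c
  have hshift : ∫ t : ℝ, G ((σ : ℂ) + (t : ℂ) * Complex.I) =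
      ∫ t : ℝ, G ((c : ℂ) + (t : ℂ) * Complex.I) := by
    refine integral_vertical_line_eq (b := b / 2)
      (K := C * Real.exp (κ * |ℓ| + b * κ ^ 2) * Real.exp (k ^ 2 / (2 * b))) hσc (half_pos hb) ?_ ?_
    · refine DifferentiableOn.mul (H.holomorphic.mono fun s hs => ?_)
        (Differentiable.differentiableOn (by fun_prop))
      exact hσ.trans_le (EReal.coe_le_coe_iff.2 hs.1)
    · intro s hs hs'
      have e1 : s - σ = ((s.re - σ : ℝ) : ℂ) + s.im * Complex.I := by
        apply Complex.ext <;> simp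
      have e2 : (s.re - σ) * ℓ ≤ κ * |ℓ| := by
        have h1 : (s.re - σ) * ℓ ≤ (s.re - σ) * |ℓ| :=
          mul_le_mul_of_nonneg_left (le_abs_self _) (by linarith)
        have h2 : (s.re - σ) * |ℓ| ≤ κ * |ℓ| :=
          mul_le_mul_of_nonneg_right (by linarith) (abs_nonneg _)
        linarith
      have e3 : (s.re - σ) ^ 2 ≤ κ ^ 2 := by
        apply pow_le_pow_left₀ <;> linarith
      rw [hGdef, norm_mul, e1, norm_cexp_line]
      calc ‖f s‖ * (Real.exp ((s.re - σ) * ℓ + b * (s.re - σ) ^ 2) * Real.exp (-b * s.im ^ 2))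
          ≤ (C * (1 + |s.im|) ^ k) *
            (Real.exp (κ * |ℓ| + b * κ ^ 2) * Real.exp (-b * s.im ^ 2)) := by
            gcongr
            exact hbd s hs hs'
        _ = C * Real.exp (κ * |ℓ| + b * κ ^ 2) *
            ((1 + |s.im|) ^ k * Real.exp (-b * s.im ^ 2)) := by ring
        _ ≤ C * Real.exp (κ * |ℓ| + b * κ ^ 2) *
            (Real.exp (k ^ 2 / (2 * b)) * Real.exp (-(b / 2) * s.im ^ 2)) := by
            exact mul_le_mul_of_nonneg_left (one_add_abs_rpow_mul_gaussian_le hk hb _)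
              (by positivity)
        _ = _ := by ring
  set F : ℕ → ℝ → ℂ := fun m t => LSeries.term a σ m *
    Complex.exp ((κ + t * Complex.I) * ((ℓ - Real.log m : ℝ) : ℂ) +
      b * (κ + t * Complex.I) ^ 2) with hF
  have hsummable : Summable (LSeries.term a c) :=
    LSeriesSummable_of_abscissaOfAbsConv_lt_re (by simpa using hc)
  have hFterm : ∀ m t, F m t = LSeries.term a ((c : ℂ) + (t : ℂ) * Complex.I) m *
      Complex.exp ((κ + t * Complex.I) * ℓ + b * (κ + t * Complex.I) ^ 2) := by
    intro m t
    have : (c : ℂ) + t * Complex.I = σ + (κ + t * Complex.I) := by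
      rw [hκ]; push_cast; ring
    simp only [hF]
    rw [this, term_eq_term_mul_cexp, mul_assoc, ← Complex.exp_add]
    congr 2
    push_cast
    ring
  have hFnorm : ∀ m t, ‖F m t‖ = ‖LSeries.term a c m‖ *
      Real.exp (κ * ℓ + b * κ ^ 2) * Real.exp (-b * t ^ 2) := by
    intro m t
    rw [hFterm, norm_mul, norm_cexp_line, LSeries.norm_term_eq, LSeries.norm_term_eq]
    simp [mul_assoc]
  have hFint : ∀ m, Integrable (F m) := by
    intro m
    refine ((integrable_exp_neg_mul_sq hb).const_mul (‖LSeries.term a c m‖ *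
      Real.exp (κ * ℓ + b * κ ^ 2))).mono' ?_ (Eventually.of_forall fun t => (hFnorm m t).le)
    exact Continuous.aestronglyMeasurable (by fun_prop)
  have hFsum : Summable fun m => ∫ t, ‖F m t‖ := by
    simp_rw [hFnorm, integral_const_mul]
    exact (hsummable.norm.mul_right _).mul_right _
  have hmain := hasSum_integral_of_summable_integral_norm hFint hFsum
  have hline : ∀ t : ℝ, ∑' m, F m t = G ((c : ℂ) + (t : ℂ) * Complex.I) := by
    intro t
    simp_rw [hFterm]
    rw [tsum_mul_right, hGdef]
    have h1 : (c : ℂ) + t * Complex.I - σ = κ + t * Complex.I := by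
      rw [hκ]; push_cast; ring
    have hre : ((c : ℂ) + t * Complex.I).re = c := by simp
    simp only [h1]
    rw [H.eq_LSeries]
    · rfl
    · rw [hre]; exact hσ.trans_le (EReal.coe_le_coe_iff.2 hσc)
    · rwa [hre]
  simp_rw [hline] at hmain
  rw [← hshift] at hmain
  convert! hmain using 2 with m
  · rw [hF]
    simp only
    rw [integral_const_mul, integral_cexp_line hb]
  · simp [hGdef]

end ContinuesDirichletSeries

/-! ### Mean values and the separation of the frequencies `log n` -/

lemma one_div_two_mul_le_abs_log_sub_log {n m N : ℕ} (hn : 1 ≤ n) (hnN : n ≤ N) (hm : 1 ≤ m)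
    (hmn : m ≠ n) : 1 / (2 * N : ℝ) ≤ |Real.log n - Real.log m| := by
  have hn0 : (0 : ℝ) < n := by exact_mod_cast hn
  have hm0 : (0 : ℝ) < m := by exact_mod_cast hm
  have hnN' : (n : ℝ) ≤ N := by exact_mod_cast hnN
  have hn1 : (1 : ℝ) ≤ n := by exact_mod_cast hn
  have hN0 : (0 : ℝ) < N := by linarith
  rcases lt_or_gt_of_ne hmn with h | h
  · have h1 := Real.one_sub_inv_le_log_of_pos (div_pos hn0 hm0)
    rw [Real.log_div hn0.ne' hm0.ne', inv_div] at h1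
    refine le_trans ?_ (h1.trans (le_abs_self _))
    have h2 : (m : ℝ) + 1 ≤ n := by exact_mod_cast h
    rw [one_sub_div hn0.ne', div_le_div_iff₀ (by positivity) hn0]
    nlinarith
  · have h1 := Real.one_sub_inv_le_log_of_pos (div_pos hm0 hn0)
    rw [Real.log_div hm0.ne' hn0.ne', inv_div] at h1
    rw [abs_sub_comm]
    refine le_trans ?_ (h1.trans (le_abs_self _))
    have h2 : (n : ℝ) + 1 ≤ m := by exact_mod_cast h
    rw [one_sub_div hm0.ne', div_le_div_iff₀ (by positivity) hm0]
    nlinarith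

/-- The terms with `m ≠ n` of the Gaussian average at frequency `log n`, weighted by `m ^ κ`, are
uniformly small. The separation `|log n - log m| ≥ 1 / (2N)` is used twice: to absorb the weight,
which also takes care of large `m`, and to gain the factor `exp (-X / 8)`. -/
lemma rpow_mul_exp_neg_log_sq_le {n m N : ℕ} {κ X : ℝ} (hn : 1 ≤ n) (hnN : n ≤ N) (hm : 1 ≤ m)
    (hmn : m ≠ n) (hκ : 0 ≤ κ) (hX : 0 ≤ X) (hκX : 4 * κ ≤ N * X) :
    (m : ℝ) ^ κ * Real.exp (-(N ^ 2 * X) * (Real.log n - Real.log m) ^ 2) ≤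
      (N : ℝ) ^ κ * Real.exp (-X / 8) := by
  have hN0 : (0 : ℝ) < N := by exact_mod_cast (hn.trans hnN)
  have hn0 : (0 : ℝ) < n := by exact_mod_cast hn
  have hm0 : (0 : ℝ) < m := by exact_mod_cast hm
  have hsep := one_div_two_mul_le_abs_log_sub_log hn hnN hm hmn
  have hlog : Real.log m ≤ Real.log N + |Real.log n - Real.log m| := by
    have h1 : Real.log n ≤ Real.log N := Real.log_le_log hn0 (by exact_mod_cast hnN)
    linarith [neg_abs_le (Real.log n - Real.log m)]
  rw [← sq_abs (Real.log n - Real.log m), Real.rpow_def_of_pos hm0, Real.rpow_def_of_pos hN0,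
    ← Real.exp_add, ← Real.exp_add]
  set L := |Real.log n - Real.log m|
  have hL : 0 ≤ L := abs_nonneg _
  have hNL : 1 / 2 ≤ N * L := by
    rw [div_le_iff₀ (by positivity)] at hsep
    linarith
  apply Real.exp_le_exp.2
  have e1 : Real.log m * κ ≤ (Real.log N + L) * κ := mul_le_mul_of_nonneg_right hlog hκ
  have e2 : 4 * κ * L ≤ N * X * L := mul_le_mul_of_nonneg_right hκX hL
  have e3 : 1 / 2 * (N * X * L) ≤ N * L * (N * X * L) :=
    mul_le_mul_of_nonneg_right hNL (by positivity)
  have e4 : 1 / 2 * X ≤ N * L * X := mul_le_mul_of_nonneg_right hNL hX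
  nlinarith

/-- The mean square of a function of growth `|t| ^ β` over the scale `b ^ (-1/2)`. -/
lemma integral_norm_sq_gaussian_le {g : ℝ → ℂ} {C β b : ℝ} (hβ : 0 ≤ β) (hb : 0 < b)
    (hgc : Continuous g) (hg : ∀ t : ℝ, ‖g t‖ ≤ C * (1 + |t|) ^ β) :
    Integrable (fun t : ℝ => ‖g t‖ ^ 2 * Real.exp (-b * t ^ 2)) ∧
    ∫ t : ℝ, ‖g t‖ ^ 2 * Real.exp (-b * t ^ 2) ≤
      √(Real.pi / b) * (C ^ 2 * Real.exp (2 * β ^ 2) * √2 * (1 + 1 / √b) ^ (2 * β)) := by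
  have hsb : 0 < √b := Real.sqrt_pos.2 hb
  set Q := C ^ 2 * Real.exp (2 * β ^ 2) * (1 + 1 / √b) ^ (2 * β) with hQ
  have hpt : ∀ t : ℝ, ‖g t‖ ^ 2 * Real.exp (-b * t ^ 2) ≤ Q * Real.exp (-(b / 2) * t ^ 2) := by
    intro t
    have h1 : 1 + |t| ≤ (1 + 1 / √b) * (1 + |√b * t|) := by
      rw [abs_mul, abs_of_pos hsb]
      have : (1 + 1 / √b) * (1 + √b * |t|) = 1 + |t| + (1 / √b + √b * |t|) := by
        field_simp
        ring
      rw [this]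
      have : 0 ≤ 1 / √b + √b * |t| := by positivity
      linarith
    have h2 : (1 + |t|) ^ (2 * β) ≤ (1 + 1 / √b) ^ (2 * β) * (1 + |√b * t|) ^ (2 * β) := by
      rw [← Real.mul_rpow (by positivity) (by positivity)]
      exact Real.rpow_le_rpow (by positivity) h1 (by positivity)
    have h3 := one_add_abs_rpow_mul_gaussian_le (k := 2 * β) (by positivity) one_pos (√b * t)
    have h4 : ‖g t‖ ^ 2 ≤ C ^ 2 * (1 + |t|) ^ (2 * β) := by
      have h5 := pow_le_pow_left₀ (norm_nonneg _) (hg t) 2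
      rw [mul_pow, ← Real.rpow_natCast ((1 + |t|) ^ β) 2, ← Real.rpow_mul (by positivity)] at h5
      rw [mul_comm 2 β]
      exact_mod_cast h5
    rw [mul_pow, Real.sq_sqrt hb.le] at h3
    calc ‖g t‖ ^ 2 * Real.exp (-b * t ^ 2)
        ≤ C ^ 2 * ((1 + 1 / √b) ^ (2 * β) * (1 + |√b * t|) ^ (2 * β)) *
          Real.exp (-1 * (b * t ^ 2)) := by
          rw [neg_one_mul, ← neg_mul]
          gcongr
          exact h4.trans (by gcongr)
      _ = C ^ 2 * (1 + 1 / √b) ^ (2 * β) *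
          ((1 + |√b * t|) ^ (2 * β) * Real.exp (-1 * (b * t ^ 2))) := by ring
      _ ≤ C ^ 2 * (1 + 1 / √b) ^ (2 * β) *
          (Real.exp ((2 * β) ^ 2 / (2 * 1)) * Real.exp (-(1 / 2) * (b * t ^ 2))) :=
          mul_le_mul_of_nonneg_left h3 (by positivity)
      _ = Q * Real.exp (-(b / 2) * t ^ 2) := by
          rw [hQ, show (2 * β) ^ 2 / (2 * 1) = 2 * β ^ 2 by ring,
            show -(1 / 2) * (b * t ^ 2) = -(b / 2) * t ^ 2 by ring]
          ring
  have hint := (integrable_exp_neg_mul_sq (half_pos hb)).const_mul Q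
  have hint' : Integrable (fun t : ℝ => ‖g t‖ ^ 2 * Real.exp (-b * t ^ 2)) := by
    refine hint.mono' (Continuous.aestronglyMeasurable (by fun_prop))
      (Eventually.of_forall fun t => ?_)
    rw [Real.norm_of_nonneg (by positivity)]
    exact hpt t
  refine ⟨hint', (integral_mono hint' hint hpt).trans (le_of_eq ?_)⟩
  rw [integral_const_mul, integral_gaussian, hQ, show Real.pi / (b / 2) = Real.pi / b * 2 by
    field_simp, Real.sqrt_mul (by positivity)]
  ring

/-- A mean value theorem for trigonometric polynomials with almost orthogonal terms. -/
lemma integral_norm_sq_sum_cexp_le {ι : Type*} (S : Finset ι) (ε : ι → ℂ) (hε : ∀ i, ‖ε i‖ ≤ 1)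
    (l : ι → ℝ) {b D : ℝ} (hb : 0 < b) (hD : 0 ≤ D)
    (hsep : ∀ i ∈ S, ∀ j ∈ S, j ≠ i → Real.exp (-(l i - l j) ^ 2 / (4 * b)) ≤ D) :
    Integrable (fun t : ℝ =>
      ‖∑ i ∈ S, ε i * Complex.exp (t * Complex.I * l i)‖ ^ 2 * Real.exp (-b * t ^ 2)) ∧
    ∫ t : ℝ, ‖∑ i ∈ S, ε i * Complex.exp (t * Complex.I * l i)‖ ^ 2 * Real.exp (-b * t ^ 2) ≤
      √(Real.pi / b) * (S.card + S.card ^ 2 * D) := by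
  classical
  set E : ι → ι → ℝ → ℂ := fun i j t =>
    Complex.exp (((0 : ℝ) + t * Complex.I) * ((l i - l j : ℝ) : ℂ) +
      b * ((0 : ℝ) + t * Complex.I) ^ 2) with hE
  have hEint : ∀ i j, Integrable (E i j) := by
    intro i j
    refine ((integrable_exp_neg_mul_sq hb).const_mul
      (Real.exp (0 * (l i - l j) + b * 0 ^ 2))).mono'
      (Continuous.aestronglyMeasurable (by fun_prop)) (Eventually.of_forall fun t => ?_)
    exact (norm_cexp_line b 0 _ t).le
  have hexpand : ∀ t : ℝ,
      ((‖∑ i ∈ S, ε i * Complex.exp (t * Complex.I * l i)‖ ^ 2 * Real.exp (-b * t ^ 2) : ℝ) : ℂ) =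
      ∑ i ∈ S, ∑ j ∈ S, ε i * (starRingEnd ℂ) (ε j) * E i j t := by
    intro t
    rw [Complex.ofReal_mul, Complex.ofReal_pow, ← Complex.mul_conj', map_sum, Finset.sum_mul_sum,
      Finset.sum_mul]
    refine Finset.sum_congr rfl fun i _ => ?_
    rw [Finset.sum_mul]
    refine Finset.sum_congr rfl fun j _ => ?_
    rw [map_mul, ← Complex.exp_conj]
    have : E i j t = Complex.exp (t * Complex.I * l i) *
        Complex.exp ((starRingEnd ℂ) (t * Complex.I * l j)) * ((Real.exp (-b * t ^ 2) : ℝ) : ℂ) := by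
      rw [Complex.ofReal_exp, ← Complex.exp_add, ← Complex.exp_add]
      simp only [hE]
      congr 1
      simp
      linear_combination (b * (t : ℂ) ^ 2) * Complex.I_sq
    rw [this]
    ring
  have hintC : Integrable fun t : ℝ =>
      ((‖∑ i ∈ S, ε i * Complex.exp (t * Complex.I * l i)‖ ^ 2 *
        Real.exp (-b * t ^ 2) : ℝ) : ℂ) := by
    simp_rw [hexpand]
    exact integrable_finsetSum _ fun i _ => integrable_finsetSum _ fun j _ =>
      (hEint i j).const_mul _
  refine ⟨hintC.re, ?_⟩
  refine (le_abs_self _).trans ?_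
  rw [← Real.norm_eq_abs, ← Complex.norm_real, ← integral_complex_ofReal]
  simp_rw [hexpand]
  rw [integral_finsetSum _ fun i _ => integrable_finsetSum _ fun j _ => (hEint i j).const_mul _]
  have hterm : ∀ i ∈ S, ∀ j ∈ S, ‖∫ t, ε i * (starRingEnd ℂ) (ε j) * E i j t‖ ≤
      √(Real.pi / b) * ((if i = j then 1 else 0) + D) := by
    intro i hi j hj
    rw [integral_const_mul, integral_cexp_line hb, norm_mul, norm_mul, RCLike.norm_conj,
      Complex.norm_real, Real.norm_of_nonneg (by positivity)]
    have h1 : ‖ε i‖ * ‖ε j‖ ≤ 1 := mul_le_one₀ (hε i) (norm_nonneg _) (hε j)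
    have h2 : Real.exp (-(l i - l j) ^ 2 / (4 * b)) ≤ (if i = j then 1 else 0) + D := by
      split_ifs with h
      · rw [h]; simp [hD]
      · simpa using hsep i hi j hj (Ne.symm h)
    calc _ ≤ 1 * (√(Real.pi / b) * Real.exp (-(l i - l j) ^ 2 / (4 * b))) := by gcongr
      _ ≤ _ := by rw [one_mul]; gcongr
  calc _ ≤ ∑ i ∈ S, ∑ j ∈ S, √(Real.pi / b) * ((if i = j then 1 else 0) + D) := by
        refine norm_sum_le_of_le _ fun i hi => ?_
        rw [integral_finsetSum _ fun j _ => (hEint i j).const_mul _]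
        exact norm_sum_le_of_le _ fun j hj => hterm i hi j hj
    _ = √(Real.pi / b) * (S.card + S.card ^ 2 * D) := by
        simp_rw [← Finset.mul_sum, Finset.sum_add_distrib]
        congr 2
        · simp
        · simp; ring

namespace ContinuesDirichletSeries

variable {a : ℕ → ℂ} {f : ℂ → ℂ} {Ω : EReal}

/-- The Gaussian average at frequency `log n` isolates the `n`-th term. The bound `D` on the other
terms carries the weight `m ^ (c - σ)` that compares the lines `σ` and `c`. -/
lemma norm_gaussian_average_sub_term_le (H : ContinuesDirichletSeries a f Ω) {σ c b D : ℝ}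
    (hσ : Ω < (σ : EReal)) (hσc : σ ≤ c) (hc : LSeries.abscissaOfAbsConv a < (c : EReal))
    (hb : 0 < b) {n : ℕ}
    (hD : ∀ m : ℕ, 1 ≤ m → m ≠ n →
      (m : ℝ) ^ (c - σ) * Real.exp (-(Real.log n - Real.log m) ^ 2 / (4 * b)) ≤ D) (hD0 : 0 ≤ D) :
    ‖(∫ t : ℝ, f ((σ : ℂ) + (t : ℂ) * Complex.I) *
        Complex.exp ((t : ℂ) * Complex.I * Real.log n + b * ((t : ℂ) * Complex.I) ^ 2)) -
      √(Real.pi / b) * LSeries.term a σ n‖ ≤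
      √(Real.pi / b) * (D * ∑' m, ‖LSeries.term a c m‖) := by
  have hsum := H.hasSum_gaussian_average hσ hσc hc hb (Real.log n)
  have hsummable : Summable (LSeries.term a c) :=
    LSeriesSummable_of_abscissaOfAbsConv_lt_re (by simpa using hc)
  have h1 := hsum.sub (hasSum_ite_eq n (√(Real.pi / b) * LSeries.term a σ n))
  have h2 := (hsummable.norm.hasSum.mul_left D).mul_left √(Real.pi / b)
  refine h1.norm_le_of_bounded h2 fun m => ?_
  split_ifs with h
  · subst h
    have : LSeries.term a σ m * ((√(Real.pi / b) *
        Real.exp (-(Real.log m - Real.log m) ^ 2 / (4 * b)) : ℝ) : ℂ) -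
        √(Real.pi / b) * LSeries.term a σ m = 0 := by
      simp; ring
    rw [this, norm_zero]
    positivity
  · rcases Nat.eq_zero_or_pos m with rfl | hm
    · simp
    have hm0 : (0 : ℝ) < m := by exact_mod_cast hm
    have e1 : ‖LSeries.term a σ m‖ = ‖LSeries.term a c m‖ * (m : ℝ) ^ (c - σ) := by
      rw [LSeries.norm_term_eq, LSeries.norm_term_eq, if_neg hm.ne', if_neg hm.ne',
        Complex.ofReal_re, Complex.ofReal_re, Real.rpow_sub hm0]
      field_simp
    rw [sub_zero, norm_mul, Complex.norm_real, Real.norm_of_nonneg (by positivity), e1]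
    calc _ = √(Real.pi / b) * (((m : ℝ) ^ (c - σ) *
          Real.exp (-(Real.log n - Real.log m) ^ 2 / (4 * b))) * ‖LSeries.term a c m‖) := by ring
      _ ≤ _ := by
        gcongr
        exact hD m hm h

end ContinuesDirichletSeries

/-! ### The abscissa of absolute convergence -/

lemma exists_norm_le_one_mul_eq_norm (z : ℂ) : ∃ ε : ℂ, ‖ε‖ ≤ 1 ∧ ε * z = ‖z‖ := by
  rcases eq_or_ne z 0 with rfl | hz
  · exact ⟨0, by simp, by simp⟩
  · refine ⟨‖z‖ / z, ?_, div_mul_cancel₀ _ hz⟩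
    rw [norm_div, Complex.norm_real, norm_norm, div_self (norm_ne_zero_iff.2 hz)]

namespace ContinuesDirichletSeries

variable {a : ℕ → ℂ} {f : ℂ → ℂ} {Ω : EReal}

/-- The duality inequality: the sum of the absolute values of the terms is the mean value of `f`
times a trigonometric polynomial with coefficients of modulus at most `1`, up to the isolation error. The
product is split with the weight `lam` into the two mean squares. -/
lemma two_mul_sum_norm_term_le (H : ContinuesDirichletSeries a f Ω) {σ c b D β C lam : ℝ}
    (hσ : Ω < (σ : EReal)) (hσc : σ ≤ c) (hc : LSeries.abscissaOfAbsConv a < (c : EReal))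
    (hb : 0 < b) (hβ : 0 ≤ β) (hlam : 0 < lam)
    (hC : ∀ t : ℝ, ‖f ((σ : ℂ) + (t : ℂ) * Complex.I)‖ ≤ C * (1 + |t|) ^ β) {N : ℕ}
    (hD : ∀ n ∈ Finset.Icc 1 N, ∀ m : ℕ, 1 ≤ m → m ≠ n →
      (m : ℝ) ^ (c - σ) * Real.exp (-(Real.log n - Real.log m) ^ 2 / (4 * b)) ≤ D)
    (hD0 : 0 ≤ D) :
    2 * ∑ n ∈ Finset.Icc 1 N, ‖LSeries.term a σ n‖ ≤
      2 * (N * (D * ∑' m, ‖LSeries.term a c m‖)) +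
        lam * (C ^ 2 * Real.exp (2 * β ^ 2) * √2 * (1 + 1 / √b) ^ (2 * β)) +
        (N + N ^ 2 * D) / lam := by
  set R := √(Real.pi / b) with hR
  have hR0 : 0 < R := Real.sqrt_pos.2 (by positivity)
  set A := ∑' m, ‖LSeries.term a c m‖ with hA
  set S := Finset.Icc 1 N with hS
  have hcard : (S.card : ℝ) = N := by simp [hS]
  choose ε hε1 hε2 using fun n => exists_norm_le_one_mul_eq_norm (LSeries.term a σ n)
  set g : ℝ → ℂ := fun t => f ((σ : ℂ) + (t : ℂ) * Complex.I) with hg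
  have hgc : Continuous g := H.continuous_vertical hσ
  obtain ⟨hFi, hFb⟩ := integral_norm_sq_gaussian_le hβ hb hgc hC
  set P : ℝ → ℂ := fun t => ∑ n ∈ S, ε n * Complex.exp (t * Complex.I * (Real.log n : ℝ)) with hP
  obtain ⟨hPi, hPb⟩ := integral_norm_sq_sum_cexp_le S ε hε1 (fun n : ℕ => Real.log n) hb hD0
    (fun n hn m hm hmn => by
      have hm1 : 1 ≤ m := (Finset.mem_Icc.1 hm).1
      refine le_trans ?_ (hD n hn m hm1 hmn)
      refine le_mul_of_one_le_left (Real.exp_pos _).le ?_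
      exact Real.one_le_rpow (by exact_mod_cast hm1) (by linarith))
  set e : ℕ → ℝ → ℂ := fun n t =>
    Complex.exp ((t : ℂ) * Complex.I * (Real.log n : ℝ) + b * ((t : ℂ) * Complex.I) ^ 2) with he
  have henorm : ∀ n t, ‖e n t‖ = Real.exp (-b * t ^ 2) := by
    intro n t
    have := norm_cexp_line b 0 (Real.log n) t
    simpa [he] using this
  have hei : ∀ n, Integrable fun t => g t * e n t := by
    intro n
    have h1 : Integrable fun t : ℝ => (‖g t‖ ^ 2 * Real.exp (-b * t ^ 2) +
        Real.exp (-b * t ^ 2)) := hFi.add (integrable_exp_neg_mul_sq hb)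
    refine h1.mono' (Continuous.aestronglyMeasurable (by fun_prop))
      (Eventually.of_forall fun t => ?_)
    rw [norm_mul, henorm]
    nlinarith [sq_nonneg (‖g t‖ - 1 / 2), Real.exp_pos (-b * t ^ 2)]
  have hcomb : ∀ t, ∑ n ∈ S, ε n * (g t * e n t) =
      g t * P t * ((Real.exp (-b * t ^ 2) : ℝ) : ℂ) := by
    intro t
    simp only [hP, Finset.mul_sum, Finset.sum_mul]
    refine Finset.sum_congr rfl fun n _ => ?_
    have : e n t = Complex.exp (t * Complex.I * (Real.log n : ℝ)) *
        ((Real.exp (-b * t ^ 2) : ℝ) : ℂ) := by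
      rw [Complex.ofReal_exp, ← Complex.exp_add]
      simp only [he]
      congr 2
      push_cast
      linear_combination (b * (t : ℂ) ^ 2) * Complex.I_sq
    rw [this]
    ring
  have hmain : ‖∑ n ∈ S, ε n * ∫ t, g t * e n t‖ ≤
      (lam * (R * (C ^ 2 * Real.exp (2 * β ^ 2) * √2 * (1 + 1 / √b) ^ (2 * β))) +
        R * (N + N ^ 2 * D) / lam) / 2 := by
    have h1 : ∑ n ∈ S, ε n * ∫ t, g t * e n t =
        ∫ t, g t * P t * ((Real.exp (-b * t ^ 2) : ℝ) : ℂ) := by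
      simp_rw [← hcomb]
      rw [integral_finsetSum _ fun n _ => (hei n).const_mul _]
      simp_rw [integral_const_mul]
    rw [h1]
    have h2 : ∀ t, ‖g t * P t * ((Real.exp (-b * t ^ 2) : ℝ) : ℂ)‖ ≤
        lam / 2 * (‖g t‖ ^ 2 * Real.exp (-b * t ^ 2)) +
          1 / (2 * lam) * (‖P t‖ ^ 2 * Real.exp (-b * t ^ 2)) := by
      intro t
      rw [norm_mul, norm_mul, Complex.norm_real, Real.norm_of_nonneg (Real.exp_pos _).le]
      have h3 : ‖g t‖ * ‖P t‖ ≤ lam / 2 * ‖g t‖ ^ 2 + 1 / (2 * lam) * ‖P t‖ ^ 2 := by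
        have h4 : 0 ≤ (lam * ‖g t‖ - ‖P t‖) ^ 2 / (2 * lam) := by positivity
        have h5 : (lam * ‖g t‖ - ‖P t‖) ^ 2 / (2 * lam) =
            lam / 2 * ‖g t‖ ^ 2 + 1 / (2 * lam) * ‖P t‖ ^ 2 - ‖g t‖ * ‖P t‖ := by
          field_simp
          ring
        linarith
      nlinarith [mul_le_mul_of_nonneg_right h3 (Real.exp_pos (-b * t ^ 2)).le]
    refine (norm_integral_le_of_norm_le ((hFi.const_mul _).add (hPi.const_mul _))
      (Eventually.of_forall h2)).trans ?_
    rw [integral_add' (hFi.const_mul _) (hPi.const_mul _), integral_const_mul, integral_const_mul]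
    rw [hcard] at hPb
    have h6 := mul_le_mul_of_nonneg_left hFb (half_pos hlam).le
    have h7 := mul_le_mul_of_nonneg_left hPb (show 0 ≤ 1 / (2 * lam) by positivity)
    refine (add_le_add h6 h7).trans (le_of_eq ?_)
    rw [hR]
    ring
  have herr : ‖∑ n ∈ S, ε n * ((∫ t, g t * e n t) - R * LSeries.term a σ n)‖ ≤
      N * (R * (D * A)) := by
    rw [← hcard, ← nsmul_eq_mul, ← Finset.sum_const]
    refine norm_sum_le_of_le _ fun n hn => ?_
    rw [norm_mul]
    have := H.norm_gaussian_average_sub_term_le hσ hσc hc hb (hD n hn) hD0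
    exact (mul_le_of_le_one_left (norm_nonneg _) (hε1 n)).trans this
  have hsum : ((R * ∑ n ∈ S, ‖LSeries.term a σ n‖ : ℝ) : ℂ) =
      ∑ n ∈ S, ε n * (∫ t, g t * e n t) -
        ∑ n ∈ S, ε n * ((∫ t, g t * e n t) - R * LSeries.term a σ n) := by
    rw [← Finset.sum_sub_distrib]
    push_cast
    rw [Finset.mul_sum]
    refine Finset.sum_congr rfl fun n _ => ?_
    rw [← hε2]
    ring
  have hnorm : R * ∑ n ∈ S, ‖LSeries.term a σ n‖ ≤
      ‖∑ n ∈ S, ε n * ∫ t, g t * e n t‖ +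
        ‖∑ n ∈ S, ε n * ((∫ t, g t * e n t) - R * LSeries.term a σ n)‖ := by
    refine le_trans ?_ (norm_sub_le _ _)
    rw [← hsum, Complex.norm_real]
    exact le_abs_self _
  refine le_of_mul_le_mul_left ?_ hR0
  have hfin := hnorm.trans (add_le_add hmain herr)
  calc R * (2 * ∑ n ∈ S, ‖LSeries.term a σ n‖)
      = 2 * (R * ∑ n ∈ S, ‖LSeries.term a σ n‖) := by ring
    _ ≤ _ := mul_le_mul_of_nonneg_left hfin zero_le_two
    _ = _ := by ring

lemma sum_norm_term_isBigO (H : ContinuesDirichletSeries a f Ω) {σ c β C η : ℝ}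
    (hσ : Ω < (σ : EReal)) (hσc : σ ≤ c) (hc : LSeries.abscissaOfAbsConv a < (c : EReal))
    (hβ : 0 ≤ β) (hη : 0 < η)
    (hC : ∀ t : ℝ, ‖f ((σ : ℂ) + (t : ℂ) * Complex.I)‖ ≤ C * (1 + |t|) ^ β) :
    (fun N : ℕ => ∑ n ∈ Finset.Icc 1 N, ‖LSeries.term a σ n‖) =O[atTop]
      fun N : ℕ => (N : ℝ) ^ (1 / 2 + (1 + η) * β) := by
  set A := ∑' m, ‖LSeries.term a c m‖ with hA
  have hA0 : 0 ≤ A := tsum_nonneg fun _ => norm_nonneg _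
  set κ := c - σ with hκ
  have hκ0 : 0 ≤ κ := sub_nonneg.2 hσc
  set K := C ^ 2 * Real.exp (2 * β ^ 2) * √2 with hK
  have hXlim : Tendsto (fun N : ℕ => (N : ℝ) ^ (2 * η)) atTop atTop :=
    (tendsto_rpow_atTop (by positivity)).comp tendsto_natCast_atTop_atTop
  -- the separation error, which is superpolynomially small
  have hsmall : ∀ᶠ N : ℕ in atTop,
      (N : ℝ) * ((N : ℝ) ^ κ * Real.exp (-(N : ℝ) ^ (2 * η) / 8)) ≤ 1 := by
    have h1 := (tendsto_rpow_mul_exp_neg_mul_atTop_nhds_zero ((κ + 1) / (2 * η)) (1 / 8)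
      (by norm_num)).comp hXlim
    filter_upwards [h1.eventually (eventually_le_nhds zero_lt_one), eventually_gt_atTop 0]
      with N hN hN0
    have hN0' : (0 : ℝ) < N := by exact_mod_cast hN0
    refine le_trans (le_of_eq ?_) hN
    simp only [Function.comp]
    rw [← Real.rpow_mul hN0'.le, mul_div_cancel₀ _ (by positivity), Real.rpow_add_one hN0'.ne']
    rw [show -(N : ℝ) ^ (2 * η) / 8 = -(1 / 8) * (N : ℝ) ^ (2 * η) by ring]
    ring
  refine Asymptotics.IsBigO.of_bound (A + K * 3 ^ (2 * β) / 2 + 1) ?_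
  filter_upwards [hsmall, hXlim.eventually_ge_atTop (4 * κ), eventually_ge_atTop 1]
    with N hN hNX hN1
  have hN1' : (1 : ℝ) ≤ N := by exact_mod_cast hN1
  have hN0 : (0 : ℝ) < N := by linarith
  set X := (N : ℝ) ^ (2 * η) with hX
  have hX0 : 0 < X := Real.rpow_pos_of_pos hN0 _
  set D := (N : ℝ) ^ κ * Real.exp (-X / 8) with hD
  have hD0 : 0 ≤ D := by positivity
  -- the Gaussian then has width `1 / √b = 2 N ^ (1 + η)`, a power of `N` beyond the separation of
  -- the frequencies
  set b : ℝ := 1 / (4 * (N ^ 2 * X)) with hb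
  have hb0 : 0 < b := by positivity
  have hsqrt : 1 / √b = 2 * (N : ℝ) ^ (1 + η) := by
    have : b = (1 / (2 * (N : ℝ) ^ (1 + η))) ^ 2 := by
      rw [hb, div_pow, mul_pow, ← Real.rpow_natCast ((N : ℝ) ^ (1 + η)) 2, ← Real.rpow_mul hN0.le,
        show (1 + η) * ((2 : ℕ) : ℝ) = (2 : ℕ) + 2 * η by push_cast; ring, Real.rpow_add hN0,
        Real.rpow_natCast, hX]
      norm_num
    rw [this, Real.sqrt_sq (by positivity), one_div_one_div]
  -- balances the two mean values in the weighted AM-GM inequality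
  set lam := (N : ℝ) ^ (1 / 2 - (1 + η) * β) with hlam
  have hlam0 : 0 < lam := Real.rpow_pos_of_pos hN0 _
  have hmain := H.two_mul_sum_norm_term_le hσ hσc hc hb0 hβ hlam0 hC (N := N) (D := D) (by
    intro n hn m hm hmn
    obtain ⟨hn1, hnN⟩ := Finset.mem_Icc.1 hn
    have := rpow_mul_exp_neg_log_sq_le (κ := κ) (X := X) hn1 hnN hm hmn hκ0 hX0.le
      (hNX.trans (le_mul_of_one_le_left hX0.le hN1'))
    convert this using 3
    rw [hb]
    field_simp) hD0
  rw [hsqrt] at hmain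
  set θ := 1 / 2 + (1 + η) * β with hθ
  have hθ0 : 0 ≤ θ := by positivity
  have h1 : 1 ≤ (N : ℝ) ^ θ := Real.one_le_rpow hN1' hθ0
  have h2 : (1 + 2 * (N : ℝ) ^ (1 + η)) ^ (2 * β) ≤
      3 ^ (2 * β) * (N : ℝ) ^ (2 * ((1 + η) * β)) := by
    rw [show 2 * ((1 + η) * β) = (1 + η) * (2 * β) by ring, Real.rpow_mul hN0.le,
      ← Real.mul_rpow (by norm_num) (by positivity)]
    refine Real.rpow_le_rpow (by positivity) ?_ (by positivity)
    have : 1 ≤ (N : ℝ) ^ (1 + η) := Real.one_le_rpow hN1' (by positivity)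
    linarith
  have h3 : lam * (K * (1 + 2 * (N : ℝ) ^ (1 + η)) ^ (2 * β)) ≤ K * 3 ^ (2 * β) * (N : ℝ) ^ θ := by
    have : lam * (N : ℝ) ^ (2 * ((1 + η) * β)) = (N : ℝ) ^ θ := by
      rw [hlam, ← Real.rpow_add hN0, hθ]
      congr 1
      ring
    rw [← this]
    have hK0 : 0 ≤ K := by positivity
    calc _ ≤ lam * (K * (3 ^ (2 * β) * (N : ℝ) ^ (2 * ((1 + η) * β)))) := by gcongr
      _ = _ := by ring
  have h4 : (N + N ^ 2 * D) / lam ≤ 2 * (N : ℝ) ^ θ := by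
    have h5 : (N : ℝ) / lam = (N : ℝ) ^ θ := by
      rw [hlam, div_eq_iff (by positivity), ← Real.rpow_add hN0, hθ]
      rw [show 1 / 2 + (1 + η) * β + (1 / 2 - (1 + η) * β) = 1 by ring, Real.rpow_one]
    rw [← h5, ← mul_div_assoc]
    gcongr
    nlinarith
  have h6 : N * (D * A) ≤ A * (N : ℝ) ^ θ := by
    nlinarith [mul_le_mul_of_nonneg_right hN hA0, mul_le_mul_of_nonneg_left h1 hA0]
  rw [Real.norm_of_nonneg (Finset.sum_nonneg fun _ _ => norm_nonneg _),
    Real.norm_of_nonneg (by positivity)]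
  nlinarith

/-- Absolute convergence holds at the distance `μ(σ) + 1/2` to the right of any line of the
half-plane. -/
lemma abscissaOfAbsConv_le (H : ContinuesDirichletSeries a f Ω) {σ : ℝ} (hσ : Ω < (σ : EReal)) :
    LSeries.abscissaOfAbsConv a ≤ ((σ + lindelofMu f σ + 1 / 2 : ℝ) : EReal) := by
  refine LSeries.abscissaOfAbsConv_le_of_forall_lt_LSeriesSummable fun y hy => ?_
  obtain ⟨c₀, hc₀, -⟩ := EReal.lt_iff_exists_real_btwn.1 H.converges
  set c := max c₀ σ
  have hc : LSeries.abscissaOfAbsConv a < (c : EReal) :=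
    hc₀.trans_le (EReal.coe_le_coe_iff.2 (le_max_left _ _))
  obtain ⟨β, hβ, hβy⟩ := exists_between (show lindelofMu f σ < y - σ - 1 / 2 by linarith)
  have hβ0 : 0 ≤ β := (lindelofMu_nonneg f σ).trans hβ.le
  obtain ⟨C, hC⟩ := H.exists_line_bound hσ hβ
  obtain ⟨η, hη, hηy⟩ : ∃ η : ℝ, 0 < η ∧ 1 / 2 + (1 + η) * β < y - σ := by
    refine ⟨(y - σ - 1 / 2 - β) / (2 * (β + 1)), div_pos (by linarith) (by positivity), ?_⟩
    have h1 : (y - σ - 1 / 2 - β) / (2 * (β + 1)) * β ≤ (y - σ - 1 / 2 - β) / 2 := by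
      rw [div_mul_eq_mul_div, div_le_div_iff₀ (by positivity) two_pos]
      nlinarith
    linarith
  have hO := H.sum_norm_term_isBigO hσ (le_max_right c₀ σ) hc hβ0 hη hC
  have hsum := LSeriesSummable_of_sum_norm_bigO (s := ((y - σ : ℝ) : ℂ)) hO (by positivity)
    (by simpa using hηy)
  refine (summable_congr fun n => ?_).1 hsum
  rcases eq_or_ne n 0 with rfl | hn
  · simp
  have hn' : (n : ℂ) ≠ 0 := by exact_mod_cast hn
  rw [LSeries.term_of_ne_zero hn, LSeries.term_of_ne_zero hn, LSeries.term_of_ne_zero hn, div_div,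
    ← Complex.cpow_add _ _ hn']
  congr 2
  push_cast
  ring

lemma lindelofMu_eq_zero (H : ContinuesDirichletSeries a f Ω) {σ : ℝ} (hσ : Ω < (σ : EReal))
    (ha : LSeries.abscissaOfAbsConv a < (σ : EReal)) : lindelofMu f σ = 0 := by
  refine le_antisymm ?_ (lindelofMu_nonneg f σ)
  refine lindelofMu_le_of_le_one_add_abs_rpow (C := ∑' m, ‖LSeries.term a σ m‖) le_rfl fun t => ?_
  have hs : Summable (LSeries.term a σ) :=
    LSeriesSummable_of_abscissaOfAbsConv_lt_re (by simpa using ha)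
  rw [Real.rpow_zero, mul_one, H.eq_LSeries _ (by simpa using hσ) (by simpa using ha)]
  refine tsum_of_norm_bounded hs.norm.hasSum fun m => ?_
  rw [LSeries.norm_term_eq, LSeries.norm_term_eq]
  simp

end ContinuesDirichletSeries

/-! ### Slopes of the order function -/

/-- A one-sided derivative of a convex function is the slope of a supporting line. -/
lemma ConvexOn.add_mul_le_of_hasSlopeAt {S : Set ℝ} {φ : ℝ → ℝ} {m x y : ℝ} (hφ : ConvexOn ℝ S φ)
    (hS : IsOpen S) (hx : x ∈ S) (hy : y ∈ S) (h : HasSlopeAt φ m x) :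
    φ x + m * (y - x) ≤ φ y := by
  rcases lt_trichotomy y x with hyx | rfl | hxy
  · have hslope : slope φ y x ≤ m := by
      rcases h with h | h
      · exact hφ.slope_le_of_hasDerivWithinAt_Iio hy hx hyx h
      · have hlim := (hasDerivWithinAt_iff_tendsto_slope' (by simp)).1 h
        have hev : ∀ᶠ z in 𝓝[>] x, z ∈ S := nhdsWithin_le_nhds (hS.mem_nhds hx)
        refine ge_of_tendsto hlim ?_
        filter_upwards [hev, self_mem_nhdsWithin] with z hz hxz
        rw [slope_def_field, slope_def_field]
        exact hφ.slope_mono_adjacent hy hz hyx hxz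
    rw [slope_def_field, div_le_iff₀ (sub_pos.2 hyx)] at hslope
    linarith
  · simp
  · have hslope : m ≤ slope φ x y := by
      rcases h with h | h
      · have hlim := (hasDerivWithinAt_iff_tendsto_slope' (by simp)).1 h
        have hev : ∀ᶠ z in 𝓝[<] x, z ∈ S := nhdsWithin_le_nhds (hS.mem_nhds hx)
        refine le_of_tendsto hlim ?_
        filter_upwards [hev, self_mem_nhdsWithin] with z hz hzx
        rw [slope_comm, slope_def_field, slope_def_field]
        exact hφ.slope_mono_adjacent hz hy hzx hxy
      · exact hφ.le_slope_of_hasDerivWithinAt_Ioi hx hy hxy h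
    rw [slope_def_field, le_div_iff₀ (sub_pos.2 hxy)] at hslope
    linarith

lemma isOpen_setOf_lt_coe (Ω : EReal) : IsOpen {σ : ℝ | Ω < (σ : EReal)} :=
  isOpen_Ioi.preimage continuous_coe_real_ereal

namespace ContinuesDirichletSeries

variable {a : ℕ → ℂ} {f : ℂ → ℂ} {Ω : EReal}

/-- If the supporting line at `σ` has slope `-s`, it lies above `0` only up to the abscissa of
absolute convergence, which is at most `σ + μ(σ) + 1/2`. -/
lemma lindelofMu_le_mul_add_half (H : ContinuesDirichletSeries a f Ω) {σ s : ℝ}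
    (hσ : Ω < (σ : EReal)) (hs : 0 < s) (h : HasSlopeAt (lindelofMu f) (-s) σ) :
    lindelofMu f σ ≤ s * (lindelofMu f σ + 1 / 2) := by
  refine le_of_forall_pos_le_add fun ε hε => ?_
  set τ := σ + lindelofMu f σ + 1 / 2 + ε / s with hτ
  have hεs : 0 < ε / s := div_pos hε hs
  have hστ : σ ≤ τ := by linarith [lindelofMu_nonneg f σ]
  have hΩτ : Ω < (τ : EReal) := hσ.trans_le (EReal.coe_le_coe_iff.2 hστ)
  have hzero : lindelofMu f τ = 0 := H.lindelofMu_eq_zero hΩτ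
    ((H.abscissaOfAbsConv_le hσ).trans_lt (EReal.coe_lt_coe_iff.2 (by linarith)))
  have hsup := H.convexOn_lindelofMu.add_mul_le_of_hasSlopeAt (isOpen_setOf_lt_coe Ω) hσ hΩτ h
  have : s * (τ - σ) = s * (lindelofMu f σ + 1 / 2) + ε := by
    rw [hτ]
    field_simp
    ring
  linarith

lemma lindelofMu_le_div (H : ContinuesDirichletSeries a f Ω) {σ s : ℝ}
    (hσ : Ω < (σ : EReal)) (hs : 0 < s) (hs1 : s < 1) (h : HasSlopeAt (lindelofMu f) (-s) σ) :
    lindelofMu f σ ≤ s / (2 * (1 - s)) := by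
  rw [le_div_iff₀ (by linarith)]
  linarith [H.lindelofMu_le_mul_add_half hσ hs h]

lemma two_mul_lindelofMu_div_le (H : ContinuesDirichletSeries a f Ω) {σ s : ℝ}
    (hσ : Ω < (σ : EReal)) (hs : 0 < s) (h : HasSlopeAt (lindelofMu f) (-s) σ) :
    2 * lindelofMu f σ / (2 * lindelofMu f σ + 1) ≤ s := by
  rw [div_le_iff₀ (by linarith [lindelofMu_nonneg f σ])]
  linarith [H.lindelofMu_le_mul_add_half hσ hs h]

lemma sub_le_of_hasDerivAt_Ioo (H : ContinuesDirichletSeries a f Ω) {x y s : ℝ}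
    (hx : Ω ≤ (x : EReal)) (hs : 0 < s) (hs1 : s < 1)
    (h : ∀ σ ∈ Set.Ioo x y, HasDerivAt (lindelofMu f) (-s) σ) :
    y - x ≤ 1 / (2 * (1 - s)) := by
  by_contra! hlt
  have hpos : 0 < 1 / (2 * (1 - s)) := by
    have : 0 < 1 - s := by linarith
    positivity
  obtain ⟨d, hd, hd'⟩ := exists_between hlt
  -- a closed subinterval of `(x, y)` of length `d`
  set u := x + (y - x - d) / 2 with hu
  set v := u + d with hv
  have hxu : x < u := by linarith
  have huv : u < v := by linarith
  have hvy : v < y := by linarith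
  have hmem : ∀ z ∈ Set.Icc u v, z ∈ Set.Ioo x y := fun z hz =>
    ⟨hxu.trans_le hz.1, hz.2.trans_lt hvy⟩
  obtain ⟨z, -, hz⟩ := exists_hasDerivAt_eq_slope (lindelofMu f) (fun _ => -s) huv
    (fun z hz => (h z (hmem z hz)).continuousAt.continuousWithinAt)
    (fun z hz => h z (hmem z (Set.Ioo_subset_Icc_self hz)))
  rw [eq_div_iff (by linarith)] at hz
  have hΩu : Ω < (u : EReal) := hx.trans_lt (EReal.coe_lt_coe_iff.2 hxu)
  have hμ := H.lindelofMu_le_div hΩu hs hs1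
    (Or.inl (h u (hmem u (Set.left_mem_Icc.2 huv.le))).hasDerivWithinAt)
  have h1 : s * d ≤ s * (1 / (2 * (1 - s))) := by
    rw [mul_one_div]
    have : v - u = d := by rw [hv]; ring
    rw [this] at hz
    linarith [lindelofMu_nonneg f v]
  exact absurd (le_of_mul_le_mul_left h1 hs) (not_le.2 hd)

/-- The right derivative of a convex function at `τ < σ` is at most any slope at `σ`. -/
lemma neg_le_slope_of_hasVerticalDegree (H : ContinuesDirichletSeries a f ⊥) {d σ m : ℝ}
    (hd : HasVerticalDegree f d) (h : HasSlopeAt (lindelofMu f) m σ) : -d ≤ m := by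
  have huniv : {σ : ℝ | (⊥ : EReal) < (σ : EReal)} = Set.univ :=
    Set.eq_univ_of_forall fun σ => EReal.bot_lt_coe σ
  have hconv := H.convexOn_lindelofMu
  rw [huniv] at hconv
  refine le_of_tendsto hd ?_
  filter_upwards [eventually_lt_atBot σ] with τ hτ
  have h1 := hconv.rightDeriv_le_slope_of_mem_interior (by simp) (Set.mem_univ σ) hτ (x := τ)
  refine h1.trans ?_
  have h2 := hconv.add_mul_le_of_hasSlopeAt isOpen_univ (Set.mem_univ σ) (Set.mem_univ τ) h
  rw [slope_def_field, div_le_iff₀ (sub_pos.2 hτ)]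
  linarith

lemma slope_neg_of_lindelofMu_pos (H : ContinuesDirichletSeries a f Ω) {σ m : ℝ}
    (hσ : Ω < (σ : EReal)) (hμ : 0 < lindelofMu f σ) (h : HasSlopeAt (lindelofMu f) m σ) :
    m < 0 := by
  by_contra! hm
  set τ := σ + lindelofMu f σ + 1 with hτ
  have hστ : σ ≤ τ := by linarith
  have hΩτ : Ω < (τ : EReal) := hσ.trans_le (EReal.coe_le_coe_iff.2 hστ)
  have hzero : lindelofMu f τ = 0 := H.lindelofMu_eq_zero hΩτ
    ((H.abscissaOfAbsConv_le hσ).trans_lt (EReal.coe_lt_coe_iff.2 (by linarith)))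
  have hsup := H.convexOn_lindelofMu.add_mul_le_of_hasSlopeAt (isOpen_setOf_lt_coe Ω) hσ hΩτ h
  nlinarith [mul_nonneg hm (sub_nonneg.2 hστ)]

end ContinuesDirichletSeries

theorem mainTheorem8 :
    (∀ (a : ℕ → ℂ) (f : ℂ → ℂ) (Ω : EReal), ContinuesDirichletSeries a f Ω →
      -- the constraint at a point
      (∀ σ s : ℝ, Ω < (σ : EReal) → 0 < s → s < 1 → HasSlopeAt (lindelofMu f) (-s) σ →
        lindelofMu f σ ≤ s / (2 * (1 - s)) ∧
        2 * lindelofMu f σ / (2 * lindelofMu f σ + 1) ≤ s ∧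
        (1 ≤ lindelofMu f σ → 2 / 3 ≤ s) ∧
        (1 / 2 ≤ lindelofMu f σ → 1 / 2 ≤ s)) ∧
      -- the length of a segment of constant slope `-s` that ends at `ω_μ`
      (∀ x y s : ℝ, Ω ≤ (x : EReal) → x < y → omegaMu f Ω = (y : EReal) → 0 < s → s < 1 →
        (∀ σ ∈ Set.Ioo x y, HasDerivAt (lindelofMu f) (-s) σ) →
        y - x ≤ 1 / (2 * (1 - s)))) ∧
    -- `s → 1` as `μ → ∞`, uniformly in all data
    (∀ ε : ℝ, 0 < ε → ∃ M : ℝ, ∀ (a : ℕ → ℂ) (f : ℂ → ℂ) (Ω : EReal),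
      ContinuesDirichletSeries a f Ω →
      ∀ σ s : ℝ, Ω < (σ : EReal) → 0 < s → s < 1 → HasSlopeAt (lindelofMu f) (-s) σ →
        M ≤ lindelofMu f σ → 1 - ε < s) ∧
    -- entire series of vertical degree one
    (∀ (a : ℕ → ℂ) (f : ℂ → ℂ), ContinuesDirichletSeries a f ⊥ → HasVerticalDegree f 1 →
      ∀ σ m : ℝ, 1 ≤ lindelofMu f σ → HasSlopeAt (lindelofMu f) m σ →
        m ∈ Set.Icc (-1 : ℝ) (-(2 / 3))) := by
  refine ⟨fun a f Ω H => ⟨fun σ s hσ hs hs1 h => ⟨H.lindelofMu_le_div hσ hs hs1 h,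
    H.two_mul_lindelofMu_div_le hσ hs h, fun hμ => ?_, fun hμ => ?_⟩,
    fun x y s hx _ _ hs hs1 h => H.sub_le_of_hasDerivAt_Ioo hx hs hs1 h⟩,
    fun ε hε => ⟨1 / ε, fun a f Ω H σ s hσ hs hs1 h hM => ?_⟩, fun a f H hd σ m hμ h => ?_⟩
  · nlinarith [H.lindelofMu_le_mul_add_half hσ hs h]
  · nlinarith [H.lindelofMu_le_mul_add_half hσ hs h]
  · have h1 := H.lindelofMu_le_mul_add_half hσ hs h
    rw [div_le_iff₀ hε] at hM
    by_contra! hle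
    nlinarith [lindelofMu_nonneg f σ]
  · have hm0 := H.slope_neg_of_lindelofMu_pos (EReal.bot_lt_coe σ) (by linarith) h
    refine ⟨H.neg_le_slope_of_hasVerticalDegree hd h, ?_⟩
    have h1 := H.lindelofMu_le_mul_add_half (s := -m) (EReal.bot_lt_coe σ) (by linarith)
      (by rwa [neg_neg])
    nlinarith
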